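/- A one-dimensional cellular automaton (CA) over a finite alphabet $A$ is a map $F:A^{\mathbb Z}\to A^{\mathbb Z}$ for which there are a finite set $U\subset\mathbb Z$ and a local rule $f:A^U\to A$ with $F(x)_m=f\big((x_{m+u})_{u\in U}\big)$ for all $x\in A^{\mathbb Z}$ and $m\in\mathbb Z$. Equip $A^{\mathbb Z}$ with the distance $d(x,y)=2^{-\min\{|i|\,:\,x_i\neq y_i\}}$ for $x\ne y$, $d(x,x)=0$. A configuration $x\in A^{\mathbb Z}$ is a (classical) equicontinuous point of $F$ if for every $\varepsilon>0$ there is $\delta>0$ such that every $y\in A^{\mathbb Z}$ with $d(x,y)<\delta$ satisfies $d(F^n(x),F^n(y))<\varepsilon$ for all $n\ge 0$. It is a Garden-of-Eden configuration of $F$ if there is no $y\in A^{\mathbb Z}$ with $F(y)=x$. There exist a finite alphabet $A$ and a one-dimensional cellular automaton $F$ on $A^{\mathbb Z}$ such that $F$ has at least one equicontinuous point and every equicontinuous point of $F$ is a Garden-of-Eden configuration. -/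

import Mathlib

/-- A one-dimensional cellular automaton over the alphabet `A`: a finite neighborhood `U ⊆ ℤ`
together with a local rule `A^U → A`. -/
structure CellularAutomaton (A : Type) where
  neighborhood : Finset ℤ
  localRule : (neighborhood → A) → A

/-- The global map `F : A^ℤ → A^ℤ`, `F(x)_m = f((x_{m+u})_{u ∈ U})`. -/
def CellularAutomaton.globalMap {A : Type} (C : CellularAutomaton A) (x : ℤ → A) : ℤ → A :=
  fun m => C.localRule (fun u => x (m + (u : ℤ)))

open Classical in
/-- The Cantor distance `d(x, y) = 2 ^ (-min {|i| : x_i ≠ y_i})` on `A^ℤ`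
(and `0` if `x = y`). -/
noncomputable def cantorDist {A : Type} (x y : ℤ → A) : ℝ :=
  if x = y then 0 else ((2 : ℝ) ^ sInf {k : ℕ | ∃ i : ℤ, i.natAbs = k ∧ x i ≠ y i})⁻¹

/-- `x` is a (classical) equicontinuous point of `F`: the iterates `F^n`, `n ∈ ℕ`, are
equicontinuous at `x` for the Cantor distance. -/
def IsEquicontinuousPoint {A : Type} (F : (ℤ → A) → (ℤ → A)) (x : ℤ → A) : Prop :=
  ∀ ε : ℝ, 0 < ε → ∃ δ : ℝ, 0 < δ ∧
    ∀ y : ℤ → A, cantorDist x y < δ → ∀ n : ℕ, cantorDist (F^[n] x) (F^[n] y) < ε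

/-- `x` is a Garden-of-Eden configuration of `F`: it has no predecessor. -/
def IsGardenOfEden {A : Type} (F : (ℤ → A) → (ℤ → A)) (x : ℤ → A) : Prop :=
  ¬ ∃ y : ℤ → A, F y = x

/-- The content of one site: a wall, a right- and a left-moving herald (`hr`, `hl`) with their
validity marks (`vr`, `vl`), right- and left-moving guards (`gr`, `gl`) and couriers (`cr`, `cl`),
the marks `mr`, `ml` recording the direction of the last herald that passed, and a seed. -/
@[ext]
structure Site where
  wall : Prop
  hr : Prop
  vr : Prop
  hl : Prop
  vl : Prop
  gr : Prop
  gl : Prop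
  cr : Prop
  cl : Prop
  mr : Prop
  ml : Prop
  seed : Prop

namespace Site

instance : Finite Site :=
  Finite.of_injective
    (fun s : Site => (s.wall, s.hr, s.vr, s.hl, s.vl, s.gr, s.gl, s.cr, s.cl, s.mr, s.ml, s.seed))
    (by rintro ⟨⟩ ⟨⟩ h; simpa using h)

/-- A right-moving herald passes from `a` to its right neighbour `c`. It is stopped by a wall
unless it is valid and does not meet a left-moving guard. -/
def entersR (a c : Site) : Prop := a.hr ∧ (c.wall → a.vr ∧ ¬c.gl)

/-- A left-moving herald passes from `b` to its left neighbour `c`. -/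
def entersL (c b : Site) : Prop := b.hl ∧ (c.wall → b.vl ∧ ¬c.gr)

/-- Heralds move by one site. Valid heralds destroy walls, and a herald kills the guard of its own
direction that it overtakes; this releases a courier in the opposite direction. -/
def heraldRule (a c b : Site) : Site where
  wall := c.wall ∧ ¬(a.hr ∧ a.vr ∧ ¬c.gl) ∧ ¬(b.hl ∧ b.vl ∧ ¬c.gr)
  hr := entersR a c
  vr := entersR a c ∧ ((a.vr ∧ ¬c.gl) ∨ (c.gl ∧ entersL c b))
  hl := entersL c b
  vl := entersL c b ∧ ((b.vl ∧ ¬c.gr) ∨ (c.gr ∧ entersR a c))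
  gr := c.gr ∧ ¬entersR a c
  gl := c.gl ∧ ¬entersL c b
  cr := c.cr ∨ (c.gl ∧ entersL c b ∧ ¬entersR a c)
  cl := c.cl ∨ (c.gr ∧ entersR a c ∧ ¬entersL c b)
  mr := (entersR a c ∧ ¬entersL c b) ∨ (¬entersR a c ∧ ¬entersL c b ∧ c.mr)
  ml := (entersL c b ∧ ¬entersR a c) ∨ (¬entersL c b ∧ ¬entersR a c ∧ c.ml)
  seed := False

/-- The right-moving guard of two colliding guards wins. -/
def winsR (a c b : Site) : Prop := (a.gr ∧ ¬c.wall) ∧ (b.gl ∧ ¬c.wall) ∧ c.mr ∧ ¬c.ml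

/-- The left-moving guard of two colliding guards wins. -/
def winsL (a c b : Site) : Prop := (b.gl ∧ ¬c.wall) ∧ (a.gr ∧ ¬c.wall) ∧ c.ml ∧ ¬c.mr

/-- Guards move by one site and are stopped by walls. Colliding guards fight; the marks decide.
A defeated guard releases a courier that follows the herald of the winner. -/
def guardRule (a c b : Site) : Site where
  wall := c.wall
  hr := c.hr
  vr := c.hr ∧ ((c.vr ∧ ¬(b.gl ∧ ¬c.wall)) ∨ winsR a c b)
  hl := c.hl
  vl := c.hl ∧ ((c.vl ∧ ¬(a.gr ∧ ¬c.wall)) ∨ winsL a c b)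
  gr := (a.gr ∧ ¬c.wall) ∧ ((b.gl ∧ ¬c.wall) → c.mr ∧ ¬c.ml)
  gl := (b.gl ∧ ¬c.wall) ∧ ((a.gr ∧ ¬c.wall) → c.ml ∧ ¬c.mr)
  cr := (c.cr ∧ ¬(b.gl ∧ ¬c.wall)) ∨ (winsR a c b ∧ ¬c.hr)
  cl := (c.cl ∧ ¬(a.gr ∧ ¬c.wall)) ∨ (winsL a c b ∧ ¬c.hl)
  mr := c.mr
  ml := c.ml
  seed := False

/-- Couriers move by one site. They are stopped by walls and by opposing guards, and make the
herald that they catch up with valid. -/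
def courierRule (a c b : Site) : Site where
  wall := c.wall
  hr := c.hr
  vr := c.hr ∧ (c.vr ∨ (a.cr ∧ ¬c.wall ∧ ¬c.gl))
  hl := c.hl
  vl := c.hl ∧ (c.vl ∨ (b.cl ∧ ¬c.wall ∧ ¬c.gr))
  gr := c.gr
  gl := c.gl
  cr := (a.cr ∧ ¬c.wall ∧ ¬c.gl) ∧ ¬c.hr
  cl := (b.cl ∧ ¬c.wall ∧ ¬c.gr) ∧ ¬c.hl
  mr := c.mr
  ml := c.ml
  seed := False

/-- A seed at an even site (`ev`) becomes a wall with heralds and guards in both directions.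
Guards at odd sites and guards at the site of their herald are removed. -/
def seedRule (ev : Prop) (c : Site) : Site where
  wall := c.wall ∨ (ev ∧ c.seed)
  hr := c.hr ∨ (ev ∧ c.seed)
  vr := c.vr ∨ (ev ∧ c.seed)
  hl := c.hl ∨ (ev ∧ c.seed)
  vl := c.vl ∨ (ev ∧ c.seed)
  gr := (c.gr ∧ ev ∧ ¬c.hr) ∨ (ev ∧ c.seed)
  gl := (c.gl ∧ ev ∧ ¬c.hl) ∨ (ev ∧ c.seed)
  cr := c.cr ∧ ¬(ev ∧ c.seed)
  cl := c.cl ∧ ¬(ev ∧ c.seed)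
  mr := c.mr
  ml := c.ml
  seed := False

/-- Exchange left and right. -/
def swap (c : Site) : Site where
  wall := c.wall
  hr := c.hl
  vr := c.vl
  hl := c.hr
  vl := c.vr
  gr := c.gl
  gl := c.gr
  cr := c.cl
  cl := c.cr
  mr := c.ml
  ml := c.mr
  seed := c.seed

end Site

open Site

/-- The map on site configurations given by a rule on three neighbouring sites. -/
def lift (rule : Site → Site → Site → Site) (x : ℤ → Site) : ℤ → Site :=
  fun i => rule (x (i - 1)) (x i) (x (i + 1))

def heraldMove : (ℤ → Site) → ℤ → Site := lift heraldRule

def guardMove : (ℤ → Site) → ℤ → Site := lift guardRule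

def courierMove : (ℤ → Site) → ℤ → Site := lift courierRule

def seedStep (x : ℤ → Site) : ℤ → Site := fun i => seedRule (i % 2 = 0) (x i)

/-- Reflection of site configurations. -/
def reflect (x : ℤ → Site) : ℤ → Site := fun i => (x (-i)).swap

theorem reflect_reflect (x : ℤ → Site) : reflect (reflect x) = x := by
  funext i
  simp [reflect, swap]

theorem reflect_lift {rule : Site → Site → Site → Site}
    (h : ∀ a c b, (rule a c b).swap = rule b.swap c.swap a.swap) (x : ℤ → Site) :
    reflect (lift rule x) = lift rule (reflect x) := by
  funext i
  simp only [reflect, lift, h]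
  rw [show -i + 1 = -(i - 1) by ring, show -i - 1 = -(i + 1) by ring]

theorem reflect_heraldMove (x : ℤ → Site) :
    reflect (heraldMove x) = heraldMove (reflect x) := by
  refine reflect_lift (fun a c b => ?_) x
  simp only [swap, heraldRule, entersR, entersL, mk.injEq, and_true]
  exact propext (and_congr_right fun _ => and_comm)

theorem reflect_guardMove (x : ℤ → Site) :
    reflect (guardMove x) = guardMove (reflect x) :=
  reflect_lift (fun _ _ _ => rfl) x

theorem reflect_courierMove (x : ℤ → Site) :
    reflect (courierMove x) = courierMove (reflect x) :=
  reflect_lift (fun _ _ _ => rfl) x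

theorem reflect_seedStep (x : ℤ → Site) :
    reflect (seedStep x) = seedStep (reflect x) := by
  funext i
  have h : ((-i) % 2 = 0) = (i % 2 = 0) := by apply propext; omega
  simp only [reflect, seedStep, h]
  rfl

/-- Facts about left-moving guards after `nf` herald moves and `ns` guard moves from a configuration
with seeds at the sites in `St`: a left-moving guard is at the distance at least `nf - ns` from
every herald in front of it, with equality only if it stems from a seed. -/
structure GuardFacts (St : ℤ → Prop) (x : ℤ → Site) (nf ns : ℤ) : Prop where
  parity : ∀ j, (x j).gl → (j - ns) % 2 = 0
  age : ∀ j k, (x j).gl → (x k).hl → k ≤ j →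
    nf - ns ≤ j - k ∧ (nf - ns = j - k → St (j + ns))
  wall : ∀ j w, (x j).gl → (x w).wall → j ≤ w → j + ns ≤ w

/-- The situation to the right of a seed at `p` as long as its right-moving guard has not met the
left-moving guard of another seed. The guard is at `p + ns` and the herald at `p + nf`. If the
herald is not valid, then a guard or a courier behind it ensures that it becomes valid before it
reaches a wall; `e` measures how far ahead of time the courier is. There are no couriers in the
first `ns + k - 1` sites. -/
structure Wedge (St : ℤ → Prop) (x : ℤ → Site) (nf ns e k p : ℤ) : Prop where
  guard : ∀ i, i = p + ns → (x i).gr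
  herald : ∀ i, i = p + nf → (x i).hr
  not_hr : ∀ i, p < i → i < p + nf → ¬(x i).hr
  eq_guard : ∀ i, p < i → i ≤ p + nf → (x i).gr → i = p + ns
  not_wall : ∀ i, p < i → i ≤ p + nf → ¬(x i).wall
  not_gl : ∀ i, p < i → i ≤ p + ns → ¬(x i).gl
  not_cl : ∀ i, p < i → i ≤ p + ns → ¬(x i).cl
  not_vl : ∀ i, p < i → i ≤ p + ns → (x i).hl → ¬(x i).vl
  not_cr : ∀ i, p < i → i < p + ns + k → ¬(x i).cr
  mark : ∀ i j, (x j).gl → p + ns < j → p + ns + j = 2 * i → i ≤ p + nf → ¬St (j + ns) →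
    (x i).mr ∧ ¬(x i).ml
  token : ∀ b, b = p + nf → ¬(x b).vr → (∃ j, p + ns < j ∧ j ≤ b ∧ (x j).gl) ∨
    ∃ j, p + ns ≤ j ∧ j < b ∧ (x j).cr ∧ ∀ w, b < w → (x w).wall → (b - j) - (w - b) ≤ e

/-- `p < q` are neighbouring seeds. -/
def Consecutive (St : ℤ → Prop) (p q : ℤ) : Prop :=
  St p ∧ St q ∧ p < q ∧ ∀ r, St r → r ≤ p ∨ q ≤ r

/-- One half of the invariant; the other half is its reflect image. -/
structure Half (St : ℤ → Prop) (x : ℤ → Site) (nf ns e k : ℤ) : Prop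
    extends GuardFacts St x nf ns where
  seed_wall : ∀ p, St p → (x p).wall
  seed_cr : ∀ p, St p → ¬(x p).cr
  seed_hr : ∀ p, St p → 0 < nf → ¬(x p).hr
  seed_gr : ∀ p, St p → 0 < ns → ¬(x p).gr
  wedge : ∀ p, St p → (∀ r, St r → p < r → 2 * ns < r - p) → Wedge St x nf ns e k p
  tie_mark : ∀ p q m, Consecutive St p q → p + q = 2 * m → m ≤ p + nf → 2 * ns < q - p →
    ¬(x m).mr
  closed : ∀ p q, Consecutive St p q → q - p ≤ 2 * ns → ∀ i, p < i → i < q →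
    ¬(x i).gr ∧ ¬(x i).cr ∧ ((x i).hr → ¬(x i).vr)

/-- The invariant of the microscopic dynamics. -/
structure Invariant (St : ℤ → Prop) (x : ℤ → Site) (nf ns e k : ℤ) : Prop where
  even : ∀ p, St p → p % 2 = 0
  right : Half St x nf ns e k
  left : Half (fun i => St (-i)) (reflect x) nf ns e k

section
variable {St : ℤ → Prop} {x : ℤ → Site} {nf ns e k : ℤ}

theorem Invariant.mirror (h : Invariant St x nf ns e k) :
    Invariant (fun i => St (-i)) (reflect x) nf ns e k where
  even p hp := by have := h.even _ hp; omega
  right := h.left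
  left := by simpa only [neg_neg, reflect_reflect] using h.right

theorem Consecutive.neg {p q : ℤ} (h : Consecutive St p q) :
    Consecutive (fun i => St (-i)) (-q) (-p) := by
  obtain ⟨hp, hq, hpq, hr⟩ := h
  refine ⟨by simpa using hq, by simpa using hp, by omega, fun r h => ?_⟩
  have := hr _ h
  omega

theorem exists_consecutive {p r : ℤ} (hp : St p) (hr : St r) (hpr : p < r) :
    ∃ q, Consecutive St p q ∧ q ≤ r := by
  classical
  obtain ⟨q, ⟨hq, hpq⟩, hmin⟩ := Int.exists_least_of_bdd (P := fun q => St q ∧ p < q)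
    ⟨p, fun z hz => hz.2.le⟩ ⟨r, hr, hpr⟩
  refine ⟨q, ⟨hp, hq, hpq, fun s hs => ?_⟩, hmin r ⟨hr, hpr⟩⟩
  by_cases h : p < s
  · exact Or.inr (hmin s ⟨hs, h⟩)
  · exact Or.inl (not_lt.1 h)

/-- The part of the mirrored wedge to the left of a seed that is used directly. -/
structure LeftWedge (x : ℤ → Site) (nf ns q : ℤ) : Prop where
  guard : ∀ i, i = q - ns → (x i).gl
  eq_guard : ∀ i, q - nf ≤ i → i < q → (x i).gl → i = q - ns
  not_gr : ∀ i, q - ns ≤ i → i < q → ¬(x i).gr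
  not_cr : ∀ i, q - ns ≤ i → i < q → ¬(x i).cr
  not_vr : ∀ i, q - ns ≤ i → i < q → (x i).hr → ¬(x i).vr

theorem Invariant.leftWedge (h : Invariant St x nf ns e k) {q : ℤ} (hq : St q)
    (hr : ∀ r, St r → r < q → 2 * ns < q - r) : LeftWedge x nf ns q := by
  have w := h.left.wedge (-q) (by simpa using hq) (fun r hr' hlt => by
    have := hr _ hr' (by omega); omega)
  have e : ∀ i, reflect x (-i) = (x i).swap := fun i => by simp [reflect]
  refine ⟨fun i hi => ?_, fun i hi hi' hg => ?_, fun i hi hi' => ?_, fun i hi hi' => ?_,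
    fun i hi hi' => ?_⟩
  · have := w.guard (-i) (by omega); rwa [e] at this
  · have := w.eq_guard (-i) (by omega) (by omega); rw [e] at this
    have := this hg; omega
  · have := w.not_gl (-i) (by omega) (by omega); rwa [e] at this
  · have := w.not_cl (-i) (by omega) (by omega); rwa [e] at this
  · have := w.not_vl (-i) (by omega) (by omega); rwa [e] at this

theorem Invariant.closed_left (h : Invariant St x nf ns e k) {p q : ℤ} (hc : Consecutive St p q)
    (hle : q - p ≤ 2 * ns) (i : ℤ) (hi : p < i) (hi' : i < q) :
    ¬(x i).gl ∧ ¬(x i).cl ∧ ((x i).hl → ¬(x i).vl) := by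
  simpa [reflect, swap] using
    h.left.closed _ _ hc.neg (by omega) (-i) (by omega) (by omega)

/-- A valid herald arriving at a seed from the right meets the guard that is just leaving. -/
theorem Invariant.guard_of_arrivalL (h : Invariant St x nf ns e k) (hns : 0 ≤ ns) {p i : ℤ} (hp : St p)
    (hi : i = p + 1) (hl : (x i).hl) (vl : (x i).vl) : (x p).gr := by
  by_cases hc : ∀ r, St r → p < r → 2 * ns < r - p
  · have w := h.right.wedge p hp hc
    rcases hns.eq_or_lt with h0 | h0
    · exact w.guard p (by omega)
    · exact (w.not_vl i (by omega) (by omega) hl vl).elim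
  · push Not at hc
    obtain ⟨r, hr, hpr, hle⟩ := hc
    obtain ⟨q, hq, hqr⟩ := exists_consecutive hp hr hpr
    have h1 := h.even _ hp
    have h2 := h.even _ hq.2.1
    have h3 := hq.2.2.1
    exact ((h.closed_left hq (by omega) i (by omega) (by omega)).2.2 hl vl).elim

/-- A valid herald arriving at a seed from the left meets the guard that is just leaving. -/
theorem Invariant.guard_of_arrivalR (h : Invariant St x nf ns e k) (hns : 0 ≤ ns) {p i : ℤ} (hp : St p)
    (hi : i = p - 1) (hr : (x i).hr) (vr : (x i).vr) : (x p).gl := by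
  have := h.mirror.guard_of_arrivalL hns (p := -p) (i := -i) (by simpa using hp) (by omega)
  simp only [reflect, swap, neg_neg] at this
  exact this hr vr

theorem Invariant.not_entersR (h : Invariant St x nf ns e k) (hns : 0 ≤ ns) {p : ℤ} (hp : St p) :
    ¬entersR (x (p - 1)) (x p) := by
  rintro ⟨h1, h2⟩
  obtain ⟨h3, h4⟩ := h2 (h.right.seed_wall p hp)
  exact h4 (h.guard_of_arrivalR hns hp rfl h1 h3)

theorem Invariant.not_entersL (h : Invariant St x nf ns e k) (hns : 0 ≤ ns) {p : ℤ} (hp : St p) :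
    ¬entersL (x p) (x (p + 1)) := by
  rintro ⟨h1, h2⟩
  obtain ⟨h3, h4⟩ := h2 (h.right.seed_wall p hp)
  exact h4 (h.guard_of_arrivalL hns hp rfl h1 h3)

end

section
variable {St : ℤ → Prop} {x : ℤ → Site} {nf ns e k : ℤ}

theorem GuardFacts.heraldMove (h : GuardFacts St x nf ns) :
    GuardFacts St (heraldMove x) (nf + 1) ns where
  parity j hj := h.parity j hj.1
  age j m hj hm hmj := by
    have hne : m ≠ j := fun hmj => hj.2 (hmj ▸ hm)
    have := h.age j (m + 1) hj.1 hm.1 (by omega)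
    exact ⟨by omega, fun he => this.2 (by omega)⟩
  wall j w hj hw hle := h.wall j w hj.1 hw.1 hle

/-- Facts on a wedge that are used for the herald that moves on from `p + nf`. -/
theorem Wedge.not_wall_next {p : ℤ} (w : Wedge St x nf ns e k p) (g : GuardFacts St x nf ns)
    (hp : p % 2 = 0) (hle : ns ≤ nf) (hlt : nf < 2 * ns ∨ nf = 0 ∧ ns = 0) (he : e ≤ -2) {b : ℤ}
    (hb : b = p + nf + 1) (hw : (x b).wall) : (x (b - 1)).vr ∧ ¬(x b).gl := by
  constructor
  · by_contra hv
    rcases w.token (b - 1) (by omega) hv with ⟨j, h1, h2, h3⟩ | ⟨j, h1, h2, h3, h4⟩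
    · have := g.wall j b h3 hw (by omega)
      omega
    · have := h4 b (by omega) hw
      omega
  · intro hg
    have h1 := g.wall b b hg hw le_rfl
    have h2 := g.parity b hg
    omega

theorem Wedge.heraldMove {p e' : ℤ} (w : Wedge St x nf ns e k p) (g : GuardFacts St x nf ns)
    (hp : p % 2 = 0) (hns : 0 ≤ ns) (hle : ns ≤ nf) (hlt : nf < 2 * ns ∨ nf = 0 ∧ ns = 0)
    (he : e ≤ -2) (hk : k ≤ 1) (he' : e + 2 ≤ e') (he'' : 2 * nf - 3 * ns ≤ e')
    (hhr : 0 < nf → ¬(x p).hr) (henter : ¬entersR (x (p - 1)) (x p)) :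
    Wedge St (heraldMove x) (nf + 1) ns e' k p := by
  have next : ∀ b, b = p + nf + 1 → entersR (x (b - 1)) (x b) := fun b hb =>
    ⟨w.herald _ (by omega), fun hw => w.not_wall_next g hp hle hlt he hb hw⟩
  have notr : ∀ i, p ≤ i → i < p + nf + 1 → ¬entersR (x (i - 1)) (x i) := by
    intro i h1 h2 h3
    rcases h1.eq_or_lt with rfl | h1
    · exact henter h3
    rcases (show p ≤ i - 1 by omega).eq_or_lt with h4 | h4
    · exact hhr (by omega) (h4 ▸ h3.1)
    · exact w.not_hr (i - 1) h4 (by omega) h3.1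
  refine ⟨fun i hi => ⟨w.guard i hi, notr i (by omega) (by omega)⟩, fun i hi => next i (by omega),
    fun i h1 h2 => notr i h1.le (by omega), fun i h1 h2 h3 => ?_, fun i h1 h2 h3 => ?_,
    fun i h1 h2 h3 => w.not_gl i h1 h2 h3.1, fun i h1 h2 h3 => ?_, fun i h1 h2 h3 h4 => ?_,
    fun i h1 h2 h3 => ?_, fun i j h1 h2 h3 h4 h5 => ?_, fun b hb h1 => ?_⟩
  · rcases (show i ≤ p + nf + 1 by omega).eq_or_lt with h4 | h4
    · exact (h3.2 (next i h4)).elim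
    · exact w.eq_guard i h1 (by omega) h3.1
  · rcases (show i ≤ p + nf + 1 by omega).eq_or_lt with h4 | h4
    · have h5 := w.not_wall_next g hp hle hlt he h4 h3.1
      exact h3.2.1 ⟨(next i h4).1, h5⟩
    · exact w.not_wall i h1 (by omega) h3.1
  · rcases h3 with h3 | h3
    · exact w.not_cl i h1 h2 h3
    · exact notr i h1.le (by omega) h3.2.1
  · rcases h4.2 with h5 | h5
    · have : i ≠ p + ns := fun hi => h5.2 (w.guard i hi)
      exact w.not_vl (i + 1) (by omega) (by omega) h3.1 h5.1
    · exact notr i h1.le (by omega) h5.2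
  · rcases h3 with h3 | h3
    · exact w.not_cr i h1 h2 h3
    · exact w.not_gl i h1 (by omega) h3.1
  · have hl : ¬entersL (x i) (x (i + 1)) := fun hl => by
      have := g.age j (i + 1) h1.1 hl.1 (by omega)
      by_cases hE : nf - ns = j - (i + 1)
      · exact h5 (this.2 hE)
      · omega
    by_cases hr : entersR (x (i - 1)) (x i)
    · exact ⟨Or.inl ⟨hr, hl⟩, fun h => h.elim (fun h => hl h.1) fun h => h.2.1 hr⟩
    · have : i ≠ p + nf + 1 := fun hi => hr (next i hi)
      have := w.mark i j h1.1 h2 h3 (by omega) h5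
      exact ⟨Or.inr ⟨hr, hl, this.1⟩, fun h => h.elim (fun h => hl h.1) fun h => this.2 h.2.2⟩
  · have hb1 := next b (by omega)
    by_cases hgl : (x b).gl
    · by_cases hl : entersL (x b) (x (b + 1))
      · exact (h1 ⟨hb1, Or.inr ⟨hgl, hl⟩⟩).elim
      · exact Or.inl ⟨b, by omega, le_rfl, hgl, hl⟩
    have hv : ¬(x (b - 1)).vr := fun hv => h1 ⟨hb1, Or.inl ⟨hv, hgl⟩⟩
    rcases w.token (b - 1) (by omega) hv with ⟨j, h2, h3, h4⟩ | ⟨j, h2, h3, h4, h5⟩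
    · by_cases hl : entersL (x j) (x (j + 1))
      · refine Or.inr ⟨j, by omega, by omega, Or.inr ⟨h4, hl, notr j (by omega) (by omega)⟩,
          fun q hq hw => ?_⟩
        have := g.wall j q h4 hw.1 (by omega)
        omega
      · exact Or.inl ⟨j, by omega, by omega, h4, hl⟩
    · refine Or.inr ⟨j, h2, by omega, Or.inl h4, fun q hq hw => ?_⟩
      have := h5 q (by omega) hw.1
      omega

theorem Invariant.heraldMove_half {e' : ℤ} (h : Invariant St x nf ns e k)
    (hns : 0 ≤ ns) (hle : ns ≤ nf) (hlt : nf < 2 * ns ∨ nf = 0 ∧ ns = 0)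
    (he : e ≤ -2) (hk : k ≤ 1) (he' : e + 2 ≤ e') (he'' : 2 * nf - 3 * ns ≤ e') :
    Half St (heraldMove x) (nf + 1) ns e' k where
  toGuardFacts := h.right.toGuardFacts.heraldMove
  seed_wall p hp := by
    refine ⟨h.right.seed_wall p hp, fun h1 => ?_, fun h1 => ?_⟩
    · exact h1.2.2 (h.guard_of_arrivalR hns hp rfl h1.1 h1.2.1)
    · exact h1.2.2 (h.guard_of_arrivalL hns hp rfl h1.1 h1.2.1)
  seed_cr p hp := by
    rintro (h1 | h1)
    · exact h.right.seed_cr p hp h1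
    · exact h.not_entersL hns hp h1.2.1
  seed_hr p hp _ := h.not_entersR hns hp
  seed_gr p hp hn h1 := h.right.seed_gr p hp hn h1.1
  wedge p hp hr := (h.right.wedge p hp hr).heraldMove h.right.toGuardFacts (h.even p hp) hns hle hlt
    he hk he' he'' (h.right.seed_hr p hp) (h.not_entersR hns hp)
  tie_mark p q m hc hm hmp hq := by
    have hr1 : ∀ r, St r → p < r → 2 * ns < r - p := fun r hr hpr => by
      have := hc.2.2.2 r hr; omega
    have hr2 : ∀ r, St r → r < q → 2 * ns < q - r := fun r hr hpr => by
      have := hc.2.2.2 r hr; omega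
    have w := h.right.wedge p hc.1 hr1
    have w' := h.leftWedge hc.2.1 hr2
    have wr := w.heraldMove h.right.toGuardFacts (h.even p hc.1) hns hle hlt
      he hk he' he'' (h.right.seed_hr p hc.1) (h.not_entersR hns hc.1)
    rintro (h1 | h1)
    · rcases hmp.eq_or_lt with h2 | h2
      · have h3 := h.left.wedge (-q) (by simpa using hc.2.1) (fun r hr' hlt => by
          have := hr2 _ hr' (by omega); omega)
        have h4 := h3.heraldMove h.left.toGuardFacts (h.mirror.even _ (by simpa using hc.2.1))
          hns hle hlt he hk he' he'' (h.left.seed_hr _ (by simpa using hc.2.1))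
          (h.mirror.not_entersR hns (by simpa using hc.2.1))
        have h5 := h4.herald (-m) (by omega)
        rw [← reflect_heraldMove] at h5
        simp only [reflect, neg_neg] at h5
        exact h1.2 h5
      · exact wr.not_hr m (by have := hc.2.2.1; omega) (by omega) h1.1
    · rcases hmp.eq_or_lt with h2 | h2
      · exact h1.1 (wr.herald m h2)
      · exact h.right.tie_mark p q m hc hm (by omega) hq h1.2.2
  closed p q hc hq i h1 h2 := by
    have old := h.right.closed p q hc hq
    have oldl := h.closed_left hc hq
    have hpq := hc.2.2.1
    refine ⟨fun h3 => (old i h1 h2).1 h3.1, ?_, fun h3 h4 => ?_⟩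
    · rintro (h3 | h3)
      · exact (old i h1 h2).2.1 h3
      · exact (oldl i h1 h2).1 h3.1
    · rcases h4.2 with h5 | h5
      · rcases (show p ≤ i - 1 by omega).eq_or_lt with h6 | h6
        · exact h.right.seed_hr p hc.1 (by omega) (h6 ▸ h3.1)
        · exact (old (i - 1) h6 (by omega)).2.2 h3.1 h5.1
      · exact (oldl i h1 h2).1 h5.1

theorem Invariant.heraldMove {e' : ℤ} (h : Invariant St x nf ns e k)
    (hns : 0 ≤ ns) (hle : ns ≤ nf) (hlt : nf < 2 * ns ∨ nf = 0 ∧ ns = 0)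
    (he : e ≤ -2) (hk : k ≤ 1) (he' : e + 2 ≤ e') (he'' : 2 * nf - 3 * ns ≤ e') :
    Invariant St (heraldMove x) (nf + 1) ns e' k where
  even := h.even
  right := h.heraldMove_half hns hle hlt he hk he' he''
  left := by
    rw [reflect_heraldMove]
    exact h.mirror.heraldMove_half hns hle hlt he hk he' he''

end

section
variable {St : ℤ → Prop} {x : ℤ → Site} {nf ns e k : ℤ}

theorem GuardFacts.guardMove (h : GuardFacts St x nf ns) :
    GuardFacts St (guardMove x) nf (ns + 1) where
  parity j hj := by
    have := h.parity (j + 1) hj.1.1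
    omega
  age j m hj hm hmj := by
    have := h.age (j + 1) m hj.1.1 hm (by omega)
    refine ⟨by omega, fun he => ?_⟩
    have := this.2 (by omega)
    rwa [show j + 1 + ns = j + (ns + 1) by ring] at this
  wall j w hj hw hle := by
    have : j ≠ w := fun hjw => hj.1.2 (hjw ▸ hw)
    have := h.wall (j + 1) w hj.1.1 hw (by omega)
    omega

theorem Wedge.guardMove {p : ℤ} (w : Wedge St x nf ns e 1 p) (g : GuardFacts St x nf ns)
    (hp : p % 2 = 0) (hns : 0 ≤ ns) (hle : ns + 1 ≤ nf) (he : 2 * nf - 3 * ns - 3 ≤ e)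
    (hr : ∀ r, St r → p < r → 2 * (ns + 1) < r - p)
    (hgr : 0 < ns → ¬(x p).gr) (hcr : ¬(x p).cr) :
    Wedge St (guardMove x) nf (ns + 1) e 0 p := by
  have guard0 : ∀ i, i = p + ns + 1 → (x (i - 1)).gr ∧ ¬(x i).wall := fun i hi =>
    ⟨w.guard _ (by omega), w.not_wall i (by omega) (by omega)⟩
  have meet : ∀ i, i = p + ns + 1 → (x (i + 1)).gl → (x i).mr ∧ ¬(x i).ml := fun i hi hg =>
    w.mark i (i + 1) hg (by omega) (by omega) (by omega) fun hs => by
      have := hr _ hs (by omega)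
      omega
  have eqg : ∀ i, p < i → i ≤ p + nf + 1 → (x (i - 1)).gr → i = p + ns + 1 := by
    intro i h1 h2 h3
    rcases (show p ≤ i - 1 by omega).eq_or_lt with h4 | h4
    · have : ¬0 < ns := fun h => hgr h (h4 ▸ h3)
      omega
    · have := w.eq_guard (i - 1) h4 (by omega) h3
      omega
  have ngl : ∀ i, p < i → i < p + ns + 1 → ¬(x (i + 1)).gl := by
    intro i h1 h2 h3
    rcases (show i + 1 ≤ p + ns + 1 by omega).eq_or_lt with h4 | h4
    · have := g.parity _ h3
      omega
    · exact w.not_gl (i + 1) (by omega) (by omega) h3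
  refine ⟨fun i hi => ⟨guard0 i (by omega), fun h => meet i (by omega) h.1⟩, w.herald, w.not_hr,
    fun i h1 h2 h3 => ?_, w.not_wall, fun i h1 h2 h3 => ?_, fun i h1 h2 h3 => ?_,
    fun i h1 h2 h3 h4 => ?_, fun i h1 h2 h3 => ?_, fun i j h1 h2 h3 h4 h5 => ?_,
    fun b hb h1 => ?_⟩
  · have := eqg i h1 (by omega) h3.1.1
    omega
  · rcases (show i ≤ p + ns + 1 by omega).eq_or_lt with h4 | h4
    · exact (h3.2 (guard0 i h4)).2 (meet i h4 h3.1.1).1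
    · exact ngl i h1 h4 h3.1.1
  · rcases (show i ≤ p + ns + 1 by omega).eq_or_lt with h4 | h4
    · rcases h3 with h3 | h3
      · exact h3.2 (guard0 i h4)
      · exact h3.1.2.2.2 (meet i h4 h3.1.1.1).1
    · rcases h3 with h3 | h3
      · exact w.not_cl i h1 (by omega) h3.1
      · exact ngl i h1 h4 h3.1.1.1
  · rcases (show i ≤ p + ns + 1 by omega).eq_or_lt with h5 | h5
    · rcases h4.2 with h6 | h6
      · exact h6.2 (guard0 i h5)
      · exact h6.2.2.2 (meet i h5 h6.1.1).1
    · rcases h4.2 with h6 | h6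
      · exact w.not_vl i h1 (by omega) h3 h6.1
      · exact ngl i h1 h5 h6.1.1
  · rcases h3 with h3 | h3
    · exact w.not_cr i h1 (by omega) h3.1
    · exact ngl i h1 (by omega) h3.1.2.1.1
  · exact w.mark i (j + 1) h1.1.1 (by omega) (by omega) h4 fun hs => h5 (by
      rwa [show j + (ns + 1) = j + 1 + ns by ring])
  · have hh := w.herald b hb
    have hnw := w.not_wall b (by omega) (by omega)
    by_cases hb1 : (x (b + 1)).gl
    · rcases (show p + ns + 1 ≤ b by omega).eq_or_lt with h2 | h2
      · exact (h1 ⟨hh, Or.inr ⟨guard0 b h2.symm, ⟨hb1, hnw⟩, meet b h2.symm hb1⟩⟩).elim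
      · refine Or.inl ⟨b, by omega, le_rfl, ⟨hb1, hnw⟩, fun h3 => ?_⟩
        have := eqg b (by omega) (by omega) h3.1
        omega
    have hv : ¬(x b).vr := fun hv => h1 ⟨hh, Or.inl ⟨hv, fun h => hb1 h.1⟩⟩
    by_cases hj : ∃ j, p + ns < j ∧ j ≤ b ∧ (x j).gl
    · obtain ⟨j, h2, h3, h4⟩ := hj
      have h5 := g.parity j h4
      obtain ⟨i, rfl⟩ : ∃ i, j = i + 1 := ⟨j - 1, by omega⟩
      have hnwi := w.not_wall i (by omega) (by omega)
      rcases (show p + ns + 1 ≤ i by omega).eq_or_lt with h6 | h6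
      · refine Or.inr ⟨i, by omega, by omega,
          Or.inr ⟨⟨guard0 i h6.symm, ⟨h4, hnwi⟩, meet i h6.symm h4⟩,
            w.not_hr i (by omega) (by omega)⟩, fun q hq hw => ?_⟩
        have := g.wall (i + 1) q h4 hw (by omega)
        omega
      · refine Or.inl ⟨i, by omega, by omega, ⟨h4, hnwi⟩, fun h7 => ?_⟩
        have := eqg i (by omega) (by omega) h7.1
        omega
    · obtain ⟨j, h2, h3, h4, h5⟩ := (w.token b hb hv).resolve_left hj
      have h6 : p + ns < j := by
        rcases h2.eq_or_lt with h6 | h6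
        · rcases hns.eq_or_lt with h7 | h7
          · exact (hcr (by rwa [show p = j by omega])).elim
          · exact (w.not_cr j (by omega) (by omega) h4).elim
        · exact h6
      exact Or.inr ⟨j, by omega, h3,
        Or.inl ⟨h4, fun h7 => hj ⟨j + 1, by omega, by omega, h7.1⟩⟩, h5⟩

theorem Invariant.guardMove_half (h : Invariant St x nf ns e 1)
    (hns : 0 ≤ ns) (hle : ns + 1 ≤ nf) (he : 2 * nf - 3 * ns - 3 ≤ e) :
    Half St (guardMove x) nf (ns + 1) e 0 where
  toGuardFacts := h.right.toGuardFacts.guardMove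
  seed_wall := h.right.seed_wall
  seed_cr p hp := by
    have := h.right.seed_wall p hp
    rintro (h1 | h1)
    · exact h.right.seed_cr p hp h1.1
    · exact h1.1.1.2 this
  seed_hr := h.right.seed_hr
  seed_gr p hp _ h1 := h1.1.2 (h.right.seed_wall p hp)
  wedge p hp hr := (h.right.wedge p hp fun r hs hpr => by have := hr r hs hpr; omega).guardMove
    h.right.toGuardFacts (h.even p hp) hns hle he hr (h.right.seed_gr p hp) (h.right.seed_cr p hp)
  tie_mark p q m hc hm hmp hq := h.right.tie_mark p q m hc hm hmp (by omega)
  closed p q hc hq i h1 h2 := by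
    have ep := h.even _ hc.1
    have eq := h.even _ hc.2.1
    have hpq := hc.2.2.1
    rcases le_or_gt (q - p) (2 * ns) with hq' | hq'
    · have old := h.right.closed p q hc hq'
      have oldl := h.closed_left hc hq'
      have ngr : ¬(x (i - 1)).gr := by
        rcases (show p ≤ i - 1 by omega).eq_or_lt with h6 | h6
        · exact h6 ▸ h.right.seed_gr p hc.1 (by omega)
        · exact (old (i - 1) h6 (by omega)).1
      refine ⟨fun h3 => ngr h3.1.1, ?_, fun h3 h4 => ?_⟩
      · rintro (h3 | h3)
        · exact (old i h1 h2).2.1 h3.1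
        · exact ngr h3.1.1.1
      · rcases h4.2 with h5 | h5
        · exact (old i h1 h2).2.2 h3 h5.1
        · exact ngr h5.1.1
    have w := h.right.wedge p hc.1 fun r hr hpr => by
      have := hc.2.2.2 r hr; omega
    have w' := h.leftWedge hc.2.1 fun r hr hpr => by
      have := hc.2.2.2 r hr; omega
    have mid : (x (i - 1)).gr → i = p + ns + 1 := fun hg => by
      rcases (show p ≤ i - 1 by omega).eq_or_lt with h6 | h6
      · have : ¬0 < ns := fun h7 => h.right.seed_gr p hc.1 h7 (h6 ▸ hg)
        omega
      rcases le_or_gt (i - 1) (p + nf) with h7 | h7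
      · have := w.eq_guard (i - 1) h6 h7 hg
        omega
      · exact (w'.not_gr (i - 1) (by omega) (by omega) hg).elim
    have mark : i = p + ns + 1 → ¬(x i).mr := fun hi =>
      h.right.tie_mark p q i hc (by omega) (by omega) (by omega)
    have gl : i = p + ns + 1 → (x (i + 1)).gl ∧ ¬(x i).wall := fun hi =>
      ⟨w'.guard _ (by omega), w.not_wall i (by omega) (by omega)⟩
    refine ⟨fun h3 => mark (mid h3.1.1) (h3.2 (gl (mid h3.1.1))).1, ?_, fun h3 h4 => ?_⟩
    · rintro (h3 | h3)
      · rcases lt_trichotomy i (p + ns + 1) with h4 | h4 | h4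
        · exact w.not_cr i h1 (by omega) h3.1
        · exact h3.2 (gl h4)
        · exact w'.not_cr i (by omega) h2 h3.1
      · exact mark (mid h3.1.1.1) h3.1.2.2.1
    · rcases h4.2 with h5 | h5
      · rcases lt_trichotomy i (p + ns + 1) with h6 | h6 | h6
        · exact w.not_hr i h1 (by omega) h3
        · exact h5.2 (gl h6)
        · exact w'.not_vr i (by omega) h2 h3 h5.1
      · exact mark (mid h5.1.1) h5.2.2.1

theorem Invariant.guardMove (h : Invariant St x nf ns e 1)
    (hns : 0 ≤ ns) (hle : ns + 1 ≤ nf) (he : 2 * nf - 3 * ns - 3 ≤ e) :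
    Invariant St (guardMove x) nf (ns + 1) e 0 where
  even := h.even
  right := h.guardMove_half hns hle he
  left := by
    rw [reflect_guardMove]
    exact h.mirror.guardMove_half hns hle he

theorem GuardFacts.courierMove (h : GuardFacts St x nf ns) :
    GuardFacts St (courierMove x) nf ns where
  parity := h.parity
  age := h.age
  wall := h.wall

theorem Wedge.courierMove {p : ℤ} (w : Wedge St x nf ns e k p) (hns : 0 ≤ ns) (hk : 0 ≤ k)
    (hcr : ¬(x p).cr) : Wedge St (courierMove x) nf ns (e - 1) 1 p := by
  have ncl : ∀ i, p < i → i ≤ p + ns → ¬((x (i + 1)).cl ∧ ¬(x i).wall ∧ ¬(x i).gr) := by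
    intro i h1 h2 h3
    have : i ≠ p + ns := fun hi => h3.2.2 (w.guard i hi)
    exact w.not_cl (i + 1) (by omega) (by omega) h3.1
  refine ⟨w.guard, w.herald, w.not_hr, w.eq_guard, w.not_wall, w.not_gl,
    fun i h1 h2 h3 => ncl i h1 h2 h3.1, fun i h1 h2 h3 h4 => ?_, fun i h1 h2 h3 => ?_, w.mark,
    fun b hb h1 => ?_⟩
  · rcases h4.2 with h5 | h5
    · exact w.not_vl i h1 h2 h3 h5
    · exact ncl i h1 h2 h5
  · rcases (show p ≤ i - 1 by omega).eq_or_lt with h4 | h4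
    · exact hcr (h4 ▸ h3.1.1)
    · exact w.not_cr (i - 1) h4 (by omega) h3.1.1
  · have hh := w.herald b hb
    rcases w.token b hb fun hv => h1 ⟨hh, Or.inl hv⟩ with h2 | ⟨j, h2, h3, h4, h5⟩
    · exact Or.inl h2
    obtain ⟨i, rfl⟩ : ∃ i, j = i - 1 := ⟨j + 1, by omega⟩
    by_cases hgl : (x i).gl
    · exact Or.inl ⟨i, by omega, by omega, hgl⟩
    have hc : (x (i - 1)).cr ∧ ¬(x i).wall ∧ ¬(x i).gl :=
      ⟨h4, w.not_wall i (by omega) (by omega), hgl⟩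
    rcases (show i ≤ b by omega).eq_or_lt with h6 | h6
    · subst h6
      exact (h1 ⟨hh, Or.inr hc⟩).elim
    · refine Or.inr ⟨i, by omega, h6, ⟨hc, w.not_hr i (by omega) (by omega)⟩, fun q hq hw => ?_⟩
      have := h5 q hq hw
      omega

theorem Invariant.courierMove_half (h : Invariant St x nf ns e k)
    (hns : 0 ≤ ns) (hk : 0 ≤ k) : Half St (courierMove x) nf ns (e - 1) 1 where
  toGuardFacts := h.right.toGuardFacts.courierMove
  seed_wall := h.right.seed_wall
  seed_cr p hp h1 := h1.1.2.1 (h.right.seed_wall p hp)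
  seed_hr := h.right.seed_hr
  seed_gr := h.right.seed_gr
  wedge p hp hr := (h.right.wedge p hp hr).courierMove hns hk (h.right.seed_cr p hp)
  tie_mark := h.right.tie_mark
  closed p q hc hq i h1 h2 := by
    have old := h.right.closed p q hc hq
    have ncr : ¬(x (i - 1)).cr := by
      rcases (show p ≤ i - 1 by omega).eq_or_lt with h6 | h6
      · exact h6 ▸ h.right.seed_cr p hc.1
      · exact (old (i - 1) h6 (by omega)).2.1
    exact ⟨(old i h1 h2).1, fun h3 => ncr h3.1.1, fun h3 h4 =>
      h4.2.elim ((old i h1 h2).2.2 h3) fun h5 => ncr h5.1⟩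

theorem Invariant.courierMove (h : Invariant St x nf ns e k)
    (hns : 0 ≤ ns) (hk : 0 ≤ k) :
    Invariant St (courierMove x) nf ns (e - 1) 1 where
  even := h.even
  right := h.courierMove_half hns hk
  left := by
    rw [reflect_courierMove]
    exact h.mirror.courierMove_half hns hk

end

/-- One time step of the site dynamics: per step, heralds move by three sites, guards by two and
couriers by eight. -/
def moveRound (x : ℤ → Site) : ℤ → Site :=
  heraldMove (courierMove^[4] (guardMove (heraldMove
    (courierMove^[4] (guardMove (heraldMove x))))))

section
variable {St St' : ℤ → Prop} {x y : ℤ → Site} {nf ns e k P Q r : ℤ}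

theorem Invariant.moveRound (hr : 0 ≤ r) (h : Invariant St x (3 * r) (2 * r) (-2) 1) :
    Invariant St (_root_.moveRound x) (3 * (r + 1)) (2 * (r + 1)) (-2) 1 := by
  have four : ∀ {x nf ns e}, 0 ≤ ns → Invariant St x nf ns e 0 →
      Invariant St (_root_.courierMove^[4] x) nf ns (e - 4) 1 := fun {x nf ns e} h0 h => by
    have := (((h.courierMove h0 le_rfl).courierMove h0 zero_le_one).courierMove h0
      zero_le_one).courierMove h0 zero_le_one
    rwa [show e - 1 - 1 - 1 - 1 = e - 4 by ring] at this
  have h1 := h.heraldMove (e' := 0) (by omega) (by omega) (by omega) (by omega) (by omega)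
    (by omega) (by omega)
  have h2 := four (by omega) (h1.guardMove (by omega) (by omega) (by omega))
  have h3 := h2.heraldMove (e' := -1) (by omega) (by omega) (by omega) (by omega) (by omega)
    (by omega) (by omega)
  have h4 := four (by omega) (h3.guardMove (by omega) (by omega) (by omega))
  have h5 := h4.heraldMove (e' := -2) (by omega) (by omega) (by omega) (by omega) (by omega)
    (by omega) (by omega)
  rwa [show 3 * r + 1 + 1 + 1 = 3 * (r + 1) by ring, show 2 * r + 1 + 1 = 2 * (r + 1) by ring] at h5

/-- Two configurations that satisfy the invariant and agree between two common seeds. -/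
structure Coupled (St St' : ℤ → Prop) (P Q : ℤ) (x y : ℤ → Site) (nf ns e k : ℤ) : Prop where
  fst : Invariant St x nf ns e k
  snd : Invariant St' y nf ns e k
  lt : P < Q
  fst_left : St P
  fst_right : St Q
  snd_left : St' P
  snd_right : St' Q
  agree : ∀ i, P ≤ i → i ≤ Q → x i = y i

theorem agree_lift {rule : Site → Site → Site → Site} (hPQ : P < Q)
    (h : ∀ i, P ≤ i → i ≤ Q → x i = y i)
    (hP : rule (x (P - 1)) (x P) (x (P + 1)) = rule (y (P - 1)) (x P) (x (P + 1)))
    (hQ : rule (x (Q - 1)) (x Q) (x (Q + 1)) = rule (x (Q - 1)) (x Q) (y (Q + 1)))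
    (i : ℤ) (hi : P ≤ i) (hi' : i ≤ Q) : lift rule x i = lift rule y i := by
  rcases hi.eq_or_lt with rfl | hi
  · simp only [lift]
    rw [hP, h P le_rfl hi', h (P + 1) (by omega) (by omega)]
  rcases hi'.eq_or_lt with rfl | hi'
  · simp only [lift]
    rw [hQ, h i hi.le le_rfl, h (i - 1) (by omega) (by omega)]
  · simp only [lift]
    rw [h i hi.le hi'.le, h (i - 1) (by omega) (by omega), h (i + 1) (by omega) (by omega)]

theorem heraldRule_congr_left {a a' c b : Site} (h : ¬entersR a c) (h' : ¬entersR a' c) :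
    heraldRule a c b = heraldRule a' c b := by
  have v : ∀ {a}, ¬entersR a c → ¬(a.hr ∧ a.vr ∧ ¬c.gl) := fun h h1 => h ⟨h1.1, fun _ => h1.2⟩
  ext <;> simp [heraldRule, h, h', v h, v h', -not_and]

theorem heraldRule_congr_right {a c b b' : Site} (h : ¬entersL c b) (h' : ¬entersL c b') :
    heraldRule a c b = heraldRule a c b' := by
  have v : ∀ {b}, ¬entersL c b → ¬(b.hl ∧ b.vl ∧ ¬c.gr) := fun h h1 => h ⟨h1.1, fun _ => h1.2⟩
  ext <;> simp [heraldRule, h, h', v h, v h', -not_and]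

theorem guardRule_congr {a a' c b b' : Site} (h : c.wall) :
    guardRule a c b = guardRule a' c b' := by
  ext <;> simp [guardRule, winsR, winsL, h]

theorem courierRule_congr {a a' c b b' : Site} (h : c.wall) :
    courierRule a c b = courierRule a' c b' := by
  ext <;> simp [courierRule, h]

theorem Coupled.heraldMove {e' : ℤ} (h : Coupled St St' P Q x y nf ns e k)
    (hns : 0 ≤ ns) (hle : ns ≤ nf) (hlt : nf < 2 * ns ∨ nf = 0 ∧ ns = 0)
    (he : e ≤ -2) (hk : k ≤ 1) (he' : e + 2 ≤ e') (he'' : 2 * nf - 3 * ns ≤ e') :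
    Coupled St St' P Q (heraldMove x) (heraldMove y) (nf + 1) ns e' k where
  __ := h
  fst := h.fst.heraldMove hns hle hlt he hk he' he''
  snd := h.snd.heraldMove hns hle hlt he hk he' he''
  agree := by
    refine agree_lift h.lt h.agree
      (heraldRule_congr_left (h.fst.not_entersR hns h.fst_left) ?_)
      (heraldRule_congr_right (h.fst.not_entersL hns h.fst_right) ?_)
    · rw [h.agree P le_rfl h.lt.le]
      exact h.snd.not_entersR hns h.snd_left
    · rw [h.agree Q h.lt.le le_rfl]
      exact h.snd.not_entersL hns h.snd_right

theorem Coupled.guardMove (h : Coupled St St' P Q x y nf ns e 1)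
    (hns : 0 ≤ ns) (hle : ns + 1 ≤ nf) (he : 2 * nf - 3 * ns - 3 ≤ e) :
    Coupled St St' P Q (guardMove x) (guardMove y) nf (ns + 1) e 0 where
  __ := h
  fst := h.fst.guardMove hns hle he
  snd := h.snd.guardMove hns hle he
  agree := agree_lift h.lt h.agree (guardRule_congr (h.fst.right.seed_wall P h.fst_left))
    (guardRule_congr (h.fst.right.seed_wall Q h.fst_right))

theorem Coupled.courierMove (h : Coupled St St' P Q x y nf ns e k)
    (hns : 0 ≤ ns) (hk : 0 ≤ k) :
    Coupled St St' P Q (courierMove x) (courierMove y) nf ns (e - 1) 1 where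
  __ := h
  fst := h.fst.courierMove hns hk
  snd := h.snd.courierMove hns hk
  agree := agree_lift h.lt h.agree (courierRule_congr (h.fst.right.seed_wall P h.fst_left))
    (courierRule_congr (h.fst.right.seed_wall Q h.fst_right))

theorem Coupled.moveRound (hr : 0 ≤ r) (h : Coupled St St' P Q x y (3 * r) (2 * r) (-2) 1) :
    Coupled St St' P Q (_root_.moveRound x) (_root_.moveRound y) (3 * (r + 1)) (2 * (r + 1)) (-2) 1 := by
  have four : ∀ {x y nf ns e}, 0 ≤ ns → Coupled St St' P Q x y nf ns e 0 →
      Coupled St St' P Q (_root_.courierMove^[4] x) (_root_.courierMove^[4] y) nf ns (e - 4) 1 :=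
    fun {x y nf ns e} h0 h => by
    have := (((h.courierMove h0 le_rfl).courierMove h0 zero_le_one).courierMove h0
      zero_le_one).courierMove h0 zero_le_one
    rwa [show e - 1 - 1 - 1 - 1 = e - 4 by ring] at this
  have h1 := h.heraldMove (e' := 0) (by omega) (by omega) (by omega) (by omega) (by omega)
    (by omega) (by omega)
  have h2 := four (by omega) (h1.guardMove (by omega) (by omega) (by omega))
  have h3 := h2.heraldMove (e' := -1) (by omega) (by omega) (by omega) (by omega) (by omega)
    (by omega) (by omega)
  have h4 := four (by omega) (h3.guardMove (by omega) (by omega) (by omega))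
  have h5 := h4.heraldMove (e' := -2) (by omega) (by omega) (by omega) (by omega) (by omega)
    (by omega) (by omega)
  rwa [show 3 * r + 1 + 1 + 1 = 3 * (r + 1) by ring, show 2 * r + 1 + 1 = 2 * (r + 1) by ring] at h5

end

/-- The active seeds of a configuration. -/
def seeds (x : ℤ → Site) (i : ℤ) : Prop := i % 2 = 0 ∧ (x i).seed

theorem half_seedStep (x : ℤ → Site) : Half (seeds x) (seedStep x) 0 0 (-2) 1 where
  parity j hj := by
    rcases hj with h | h
    · simpa using h.2.1
    · simpa using h.1
  age j m hj hm hmj := by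
    refine ⟨by omega, fun he => ?_⟩
    obtain rfl : j = m := by omega
    rw [add_zero]
    rcases hm with hm | hm
    · exact hj.elim (fun h => (h.2.2 hm).elim) id
    · exact hm
  wall j w _ _ h := by omega
  seed_wall p hp := Or.inr hp
  seed_cr p hp h := h.2 hp
  seed_hr p _ h := (lt_irrefl _ h).elim
  seed_gr p _ h := (lt_irrefl _ h).elim
  wedge p hp _ := by
    refine ⟨fun i hi => ?_, fun i hi => ?_, fun i _ _ => by omega, fun i _ _ => by omega,
      fun i _ _ => by omega, fun i _ _ => by omega, fun i _ _ => by omega, fun i _ _ => by omega,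
      fun i _ _ => by omega, fun i j _ _ _ => by omega, fun b hb hv => ?_⟩
    · obtain rfl : i = p := by omega
      exact Or.inr hp
    · obtain rfl : i = p := by omega
      exact Or.inr hp
    · obtain rfl : b = p := by omega
      exact (hv (Or.inr hp)).elim
  tie_mark p q m hc := by
    have := hc.2.2.1
    omega
  closed p q hc := by
    have := hc.2.2.1
    omega

theorem seeds_reflect (x : ℤ → Site) : seeds (reflect x) = fun i => seeds x (-i) := by
  funext i
  simp only [seeds, reflect, swap, eq_iff_iff]
  exact and_congr_left fun _ => by omega

theorem invariant_seedStep (x : ℤ → Site) : Invariant (seeds x) (seedStep x) 0 0 (-2) 1 where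
  even _ hp := hp.1
  right := half_seedStep x
  left := by
    rw [reflect_seedStep, ← seeds_reflect]
    exact half_seedStep (reflect x)

theorem invariant_iterate (x : ℤ → Site) (n : ℕ) :
    Invariant (seeds x) (moveRound^[n] (seedStep x)) (3 * n) (2 * n) (-2) 1 := by
  induction n with
  | zero => simpa using invariant_seedStep x
  | succ n ih =>
    rw [Function.iterate_succ_apply']
    exact_mod_cast ih.moveRound (by omega)

theorem Invariant.not_hl_of_gl {St : ℤ → Prop} {x : ℤ → Site} {nf ns e k : ℤ}
    (h : Invariant St x nf ns e k) (hlt : ns < nf) (i : ℤ) (hi : (x i).gl) : ¬(x i).hl := by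
  intro hl
  have := h.right.age i i hi hl le_rfl
  omega

theorem seedStep_moveRound (x : ℤ → Site) (n : ℕ) :
    seedStep (moveRound^[n + 1] (seedStep x)) = moveRound^[n + 1] (seedStep x) := by
  have h := invariant_iterate x (n + 1)
  have hs : ∀ i, ¬(moveRound^[n + 1] (seedStep x) i).seed := fun i hi => by
    rw [Function.iterate_succ_apply'] at hi
    exact hi
  generalize moveRound^[n + 1] (seedStep x) = y at h hs
  have hl := h.not_hl_of_gl (by push_cast; omega)
  have hr := h.mirror.not_hl_of_gl (by push_cast; omega)
  have pl := h.right.parity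
  have pr := h.left.parity
  funext i
  have hgr : (y i).gr → i % 2 = 0 ∧ ¬(y i).hr := fun hg => by
    have h1 := pr (-i) (by simpa [reflect, swap] using hg)
    have h2 := hr (-i) (by simpa [reflect, swap] using hg)
    simp only [reflect, swap, neg_neg] at h2
    exact ⟨by push_cast at h1; omega, h2⟩
  have hgl : (y i).gl → i % 2 = 0 ∧ ¬(y i).hl := fun hg => by
    have h1 := pl i hg
    exact ⟨by push_cast at h1; omega, hl i hg⟩
  ext <;> simp only [seedStep, seedRule, hs i, and_false, or_false, not_false_eq_true, and_true,
    and_iff_left_of_imp hgr, and_iff_left_of_imp hgl]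

theorem coupled_iterate {x y : ℤ → Site} {P Q : ℤ} (hPQ : P < Q) (hxP : seeds x P)
    (hxQ : seeds x Q) (h : ∀ i, P ≤ i → i ≤ Q → x i = y i) (n : ℕ) :
    Coupled (seeds x) (seeds y) P Q (moveRound^[n] (seedStep x)) (moveRound^[n] (seedStep y))
      (3 * n) (2 * n) (-2) 1 := by
  induction n with
  | zero =>
    refine ⟨invariant_iterate x 0, invariant_iterate y 0, hPQ, hxP, hxQ, ?_, ?_, fun i hi hi' => ?_⟩
    · rwa [seeds, ← h P le_rfl hPQ.le]
    · rwa [seeds, ← h Q hPQ.le le_rfl]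
    · simp only [Function.iterate_zero, id, seedStep, h i hi hi']
  | succ n ih =>
    rw [Function.iterate_succ_apply', Function.iterate_succ_apply']
    exact_mod_cast ih.moveRound (by omega)

/-- The values of `T x` are determined by the values of `x` within distance `r`. -/
def DependsWithin (r : ℤ) (T : (ℤ → Site) → ℤ → Site) : Prop :=
  ∀ x y i, (∀ j, i - r ≤ j → j ≤ i + r → x j = y j) → T x i = T y i

/-- `T` commutes with the translation by `t`. -/
def CommutesShift (t : ℤ) (T : (ℤ → Site) → ℤ → Site) : Prop :=
  ∀ x i, T (fun j => x (t + j)) i = T x (t + i)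

theorem DependsWithin.comp {r s : ℤ} {T U : (ℤ → Site) → ℤ → Site} (hT : DependsWithin r T)
    (hU : DependsWithin s U) : DependsWithin (r + s) (T ∘ U) := fun x y i h =>
  hT _ _ _ fun j h1 h2 => hU _ _ _ fun m h3 h4 => h m (by omega) (by omega)

theorem CommutesShift.comp {t : ℤ} {T U : (ℤ → Site) → ℤ → Site} (hT : CommutesShift t T)
    (hU : CommutesShift t U) : CommutesShift t (T ∘ U) := fun x i => by
  have : U (fun j => x (t + j)) = fun j => U x (t + j) := funext fun j => hU x j
  simp only [Function.comp_apply, this]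
  exact hT (U x) i

theorem dependsWithin_lift (rule : Site → Site → Site → Site) : DependsWithin 1 (lift rule) :=
  fun x y i h => by
    simp only [lift]
    rw [h i (by omega) (by omega), h (i - 1) (by omega) (by omega), h (i + 1) (by omega) (by omega)]

theorem commutesShift_lift (t : ℤ) (rule : Site → Site → Site → Site) :
    CommutesShift t (lift rule) := fun x i => by
  simp only [lift, add_sub_assoc, add_assoc]

theorem dependsWithin_seedStep : DependsWithin 0 seedStep := fun x y i h => by
  simp only [seedStep]
  rw [h i (by omega) (by omega)]

theorem commutesShift_seedStep (m : ℤ) : CommutesShift (2 * m) seedStep := fun x i => by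
  simp only [seedStep]
  rw [show (2 * m + i) % 2 = i % 2 by omega]

theorem dependsWithin_moveRound : DependsWithin 13 (moveRound ∘ seedStep) := by
  have l := dependsWithin_lift
  have c := (((l courierRule).comp (l courierRule)).comp (l courierRule)).comp (l courierRule)
  exact ((((((l heraldRule).comp c).comp (l guardRule)).comp (l heraldRule)).comp c).comp
    (l guardRule)).comp (l heraldRule) |>.comp dependsWithin_seedStep

theorem commutesShift_moveRound (m : ℤ) : CommutesShift (2 * m) (moveRound ∘ seedStep) := by
  have l := commutesShift_lift (2 * m)
  have c := (((l courierRule).comp (l courierRule)).comp (l courierRule)).comp (l courierRule)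
  exact ((((((l heraldRule).comp c).comp (l guardRule)).comp (l heraldRule)).comp c).comp
    (l guardRule)).comp (l heraldRule) |>.comp (commutesShift_seedStep m)

/-- Two neighbouring sites form a cell; this map lists the sites of a configuration of cells. -/
def toSites (c : ℤ → Site × Site) (i : ℤ) : Site :=
  if i % 2 = 0 then (c (i / 2)).1 else (c (i / 2)).2

/-- The configuration of cells with the given sites. -/
def ofSites (x : ℤ → Site) (m : ℤ) : Site × Site := (x (2 * m), x (2 * m + 1))

theorem toSites_even (c : ℤ → Site × Site) (m : ℤ) : toSites c (2 * m) = (c m).1 := by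
  simp [toSites]

theorem toSites_odd (c : ℤ → Site × Site) (m : ℤ) : toSites c (2 * m + 1) = (c m).2 := by
  have h1 : (2 * m + 1) % 2 = 1 := by omega
  have h2 : (2 * m + 1) / 2 = m := by omega
  simp [toSites, h1, h2]

theorem toSites_ofSites (x : ℤ → Site) : toSites (ofSites x) = x := by
  funext i
  obtain ⟨m, rfl | rfl⟩ := Int.even_or_odd' i
  · rw [toSites_even, ofSites]
  · rw [toSites_odd, ofSites]

theorem toSites_congr {c c' : ℤ → Site × Site} {a b : ℤ} (h : ∀ m, a ≤ m → m ≤ b → c m = c' m)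
    (i : ℤ) (hi : 2 * a ≤ i) (hi' : i ≤ 2 * b + 1) : toSites c i = toSites c' i := by
  simp only [toSites]
  rw [h (i / 2) (by omega) (by omega)]

/-- One step of the dynamics on cells. -/
def cellStep (c : ℤ → Site × Site) : ℤ → Site × Site := ofSites (moveRound (seedStep (toSites c)))

theorem cellStep_iterate (c : ℤ → Site × Site) (n : ℕ) :
    cellStep^[n + 1] c = ofSites (moveRound^[n + 1] (seedStep (toSites c))) := by
  induction n with
  | zero => rfl
  | succ n ih =>
    rw [Function.iterate_succ_apply', ih, cellStep, toSites_ofSites, seedStep_moveRound,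
      ← Function.iterate_succ_apply' moveRound]

/-- A map that is determined locally and commutes with translations is a cellular automaton. -/
theorem exists_globalMap_eq {A : Type} [Nonempty A] (T : (ℤ → A) → ℤ → A) (r : ℤ)
    (hloc : ∀ x y, (∀ j, -r ≤ j → j ≤ r → x j = y j) → T x 0 = T y 0)
    (hshift : ∀ x m, T (fun j => x (m + j)) 0 = T x m) :
    ∃ C : CellularAutomaton A, C.globalMap = T := by
  classical
  obtain ⟨a⟩ := ‹Nonempty A›
  refine ⟨⟨Finset.Icc (-r) r, fun u =>
    T (fun j => if h : j ∈ Finset.Icc (-r) r then u ⟨j, h⟩ else a) 0⟩, ?_⟩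
  funext x m
  rw [← hshift x m]
  refine hloc _ _ fun j h1 h2 => ?_
  simp [h1, h2]

theorem exists_globalMap_eq_cellStep :
    ∃ C : CellularAutomaton (Site × Site), C.globalMap = cellStep := by
  have : Nonempty Site := ⟨⟨True, True, True, True, True, True, True, True, True, True, True, True⟩⟩
  refine exists_globalMap_eq cellStep 7 (fun x y h => ?_) fun x m => ?_
  · have key : ∀ i, 0 ≤ i → i ≤ 1 →
        (moveRound ∘ seedStep) (toSites x) i = (moveRound ∘ seedStep) (toSites y) i :=
      fun i h0 h1 => dependsWithin_moveRound _ _ _ fun j h2 h3 =>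
        toSites_congr h j (by omega) (by omega)
    exact Prod.ext (key 0 le_rfl zero_le_one) (key 1 zero_le_one le_rfl)
  · have hs : toSites (fun j => x (m + j)) = fun j => toSites x (2 * m + j) := by
      funext j
      simp only [toSites]
      rw [show (2 * m + j) % 2 = j % 2 by omega, show (2 * m + j) / 2 = m + j / 2 by omega]
    have key := commutesShift_moveRound m (toSites x)
    rw [← hs] at key
    exact Prod.ext ((key 0).trans (congrArg _ (add_zero _))) (key 1)

section Distance
variable {A : Type}

theorem cantorDist_le {x y : ℤ → A} {K : ℕ} (h : ∀ i : ℤ, i.natAbs < K → x i = y i) :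
    cantorDist x y ≤ ((2 : ℝ) ^ K)⁻¹ := by
  unfold cantorDist
  split_ifs with hxy
  · positivity
  · obtain ⟨i, hi⟩ := Function.ne_iff.1 hxy
    have hne : {k : ℕ | ∃ i : ℤ, i.natAbs = k ∧ x i ≠ y i}.Nonempty := ⟨_, i, rfl, hi⟩
    obtain ⟨j, hj, hj'⟩ := Nat.sInf_mem hne
    have : K ≤ sInf {k : ℕ | ∃ i : ℤ, i.natAbs = k ∧ x i ≠ y i} := by
      by_contra hlt
      exact hj' (h j (by omega))
    gcongr
    norm_num

theorem eq_of_cantorDist_lt {x y : ℤ → A} {K : ℕ} (h : cantorDist x y < ((2 : ℝ) ^ K)⁻¹) {i : ℤ}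
    (hi : i.natAbs ≤ K) : x i = y i := by
  by_contra hne
  have hxy : x ≠ y := fun h => hne (h ▸ rfl)
  rw [cantorDist, if_neg hxy] at h
  have h1 : sInf {k : ℕ | ∃ i : ℤ, i.natAbs = k ∧ x i ≠ y i} ≤ i.natAbs :=
    Nat.sInf_le ⟨i, rfl, hne⟩
  refine absurd h (not_lt.2 ?_)
  gcongr
  · norm_num
  · omega

theorem exists_inv_two_pow_lt {ε : ℝ} (hε : 0 < ε) : ∃ K : ℕ, ((2 : ℝ) ^ K)⁻¹ < ε := by
  obtain ⟨K, hK⟩ := exists_pow_lt_of_lt_one hε (by norm_num : (2 : ℝ)⁻¹ < 1)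
  exact ⟨K, by rwa [← inv_pow]⟩

end Distance

/-- A site with nothing but a seed. -/
def seedSite : Site :=
  ⟨False, False, False, False, False, False, False, False, False, False, False, True⟩

theorem isEquicontinuousPoint_seedSite :
    IsEquicontinuousPoint cellStep (fun _ => (seedSite, seedSite)) := by
  intro ε hε
  obtain ⟨K, hK⟩ := exists_inv_two_pow_lt hε
  refine ⟨((2 : ℝ) ^ K)⁻¹, by positivity, fun y hy n => lt_of_le_of_lt (cantorDist_le ?_) hK⟩
  have hxy := fun i hi => eq_of_cantorDist_lt hy (i := i) hi
  intro i hi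
  cases n with
  | zero => exact hxy i hi.le
  | succ n =>
    have hs : ∀ m : ℤ, seeds (toSites fun _ => (seedSite, seedSite)) (2 * m) := fun m =>
      ⟨by omega, by rw [toSites_even]; trivial⟩
    have hsites := toSites_congr (a := -K) (b := K) fun m h1 h2 => hxy m (by omega)
    have hc := (coupled_iterate (P := 2 * -K) (Q := 2 * K) (by omega) (hs _) (hs _)
      (fun i h1 h2 => hsites i h1 (by omega)) (n + 1)).agree
    rw [cellStep_iterate, cellStep_iterate]
    exact Prod.ext (hc _ (by omega) (by omega)) (hc _ (by omega) (by omega))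

theorem not_isEquicontinuousPoint {c : ℤ → Site × Site} (hc : ∀ m, ¬(c m).1.seed) :
    ¬IsEquicontinuousPoint cellStep c := by
  intro h
  obtain ⟨δ, hδ, hy⟩ := h 1 one_pos
  obtain ⟨K, hK⟩ := exists_inv_two_pow_lt hδ
  let y : ℕ → ℤ → Site × Site := fun M => Function.update c M (seedSite, seedSite)
  have hseeds : ∀ M i, seeds (toSites (y M)) i → i = 2 * M := by
    rintro M i ⟨h1, h2⟩
    obtain ⟨m, rfl⟩ : ∃ m, i = 2 * m := ⟨i / 2, by omega⟩
    rw [toSites_even] at h2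
    by_contra hne
    have : m ≠ M := by omega
    exact hc m (by simpa [y, this] using h2)
  have hseed : ∀ M : ℕ, seeds (toSites (y M)) (2 * M) := fun M =>
    ⟨by omega, by simp [toSites_even, y, seedSite]⟩
  have hw : ∀ M n : ℕ,
      LeftWedge (moveRound^[n] (seedStep (toSites (y M)))) (3 * n) (2 * n) (2 * M) :=
    fun M n => (invariant_iterate _ n).leftWedge (hseed M) fun r hr hlt => by
      have := hseeds M r hr
      omega
  have hclose : ∀ M, K ≤ M → cellStep^[K + 2] c 0 = cellStep^[K + 2] (y M) 0 := fun M hM => by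
    have hd : cantorDist c (y M) < δ := lt_of_le_of_lt (cantorDist_le fun i hi => by
      have : i ≠ M := by omega
      simp [y, this]) hK
    exact eq_of_cantorDist_lt (K := 0) (by simpa using hy _ hd (K + 2)) (by simp)
  have heq := (hclose (K + 2) (by omega)).symm.trans (hclose (K + 3) (by omega))
  rw [cellStep_iterate, cellStep_iterate] at heq
  have h0 : (moveRound^[K + 2] (seedStep (toSites (y (K + 2)))) 0).gl :=
    (hw (K + 2) (K + 2)).guard 0 (by push_cast; omega)
  rw [show moveRound^[K + 2] (seedStep (toSites (y (K + 2)))) 0 =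
    moveRound^[K + 2] (seedStep (toSites (y (K + 3)))) 0 from congrArg Prod.fst heq] at h0
  have := (hw (K + 3) (K + 2)).eq_guard 0 (by push_cast; omega) (by push_cast; omega) h0
  push_cast at this
  omega

theorem mainTheorem8 :
    ∃ (A : Type) (_ : Fintype A) (C : CellularAutomaton A),
      (∃ x : ℤ → A, IsEquicontinuousPoint C.globalMap x) ∧
      ∀ x : ℤ → A, IsEquicontinuousPoint C.globalMap x → IsGardenOfEden C.globalMap x := by
  obtain ⟨C, hC⟩ := exists_globalMap_eq_cellStep
  refine ⟨Site × Site, Fintype.ofFinite _, C, ?_⟩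
  rw [hC]
  refine ⟨⟨_, isEquicontinuousPoint_seedSite⟩, ?_⟩
  rintro _ hx ⟨z, rfl⟩
  exact not_isEquicontinuousPoint (fun _ => id) hx
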